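/- Let $d$ be a positive integer, let $F\subseteq\mathbb{Z}^d$ be a finite set with $|F|=k\ge 3$, and let $\mu$ be a real number with $0<\mu<\frac{k-1}{k}$. Call a set $F'\subseteq\mathbb{Z}^d$ a homothetic copy of $F$ if $F'=v+\lambda F=\{v+\lambda f : f\in F\}$ for some $v\in\mathbb{Z}^d$ and some positive integer $\lambda$. Call a set $Z\subseteq\mathbb{Z}^d$ $F$-free if there is no nonzero real $\lambda$ such that $Z$ contains a congruent copy of $\lambda F$, that is, a subset admitting a bijection onto $\lambda F=\{\lambda f : f\in F\}\subseteq\mathbb{R}^d$ that preserves Euclidean distances. Then there is a set $X\subseteq\mathbb{N}^d$ of lattice points, where $\mathbb{N}=\{1,2,3,\dots\}$, depending only on $F$ and $\mu$, such that (i) for every integer $r\ge 1$, every $r$-colouring of $X$ contains a monochromatic homothetic copy of $F$; (ii) every finite subset $Y\subseteq X$ has an $F$-free subset $Z\subseteq Y$ of size $|Z|\ge\mu|Y|$. -/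

import Mathlib

open scoped Pointwise

/-- The inclusion of the integer lattice `ℤ^d` into Euclidean space `ℝ^d`. -/
def latticeToEuclidean {d : ℕ} (x : Fin d → ℤ) : EuclideanSpace ℝ (Fin d) :=
  WithLp.toLp 2 (fun i => (x i : ℝ))

/-- `F'` is a homothetic copy of `F`: it is `v + l F` for a lattice vector `v`
and a positive integer `l`. -/
def IsHomotheticCopy {d : ℕ} (F F' : Set (Fin d → ℤ)) : Prop :=
  ∃ (v : Fin d → ℤ) (l : ℤ), 0 < l ∧ F' = (fun f => v + l • f) '' F

/-- Two point sets are congruent if there is a distance-preserving bijection between them. -/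
def SetsCongruent {E : Type*} [PseudoEMetricSpace E] (A B : Set E) : Prop :=
  ∃ e : A ≃ B, Congruent (fun a : A => (a : E)) (fun a : A => (e a : E))

/-- `Z` is `F`-free: for no nonzero real `c` does `Z` contain a congruent copy of `c F`,
where congruence and scaling are those of Euclidean space. -/
def IsConfigFree {d : ℕ} (F Z : Set (Fin d → ℤ)) : Prop :=
  ¬ ∃ c : ℝ, c ≠ 0 ∧ ∃ W : Set (EuclideanSpace ℝ (Fin d)),
    W ⊆ latticeToEuclidean '' Z ∧ SetsCongruent W (c • (latticeToEuclidean '' F))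

/-! The density comes from a shift hypergraph, and the geometry from a partite construction over it.
Vertices of the shift hypergraph are injective sequences of length `m` in `Fin N`; an edge consists
of the `k` consecutive windows of a longer sequence. Ramsey's theorem makes some edge monochromatic
(`exists_mono_windows`). Given a permutation `σ`, call a window good if its `σ`-maximum sits far
from both ends at a position not divisible by `k`. No edge is entirely good (`exists_not_peakGood`),
yet for random `σ` each window is good with probability close to `(k-1)/k`, hence at least `μ` for
suitable `m` (`card_peakGood`, `exists_card_peak_ge`).

A picture is a finite lattice set projecting to the vertices so that every nondegenerate similar
copy of `F` in it lies over an edge. Keeping the points over good windows, for the best `σ`, then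
leaves no such copy in any prescribed subset. Pictures in which the colour can be made to depend
only on the vertex are built one vertex at a time by Hales–Jewett amalgamation
(`exists_picture_insert`). Words of lattice points are turned into lattice points by a weighted sum
with positive weights: this preserves homotheties, and for generic weights a similarity of the sums
is a similarity in every coordinate (`exists_generic_weights`).

This yields one finite set for each number of colours. Far translates of these sets are united
(`exists_similarityFractional_union`), and `X` is the union of the resulting chain. -/

/-- The squared Euclidean distance of two lattice points. -/
def sqDist {d : ℕ} (x y : Fin d → ℤ) : ℤ := (x - y) ⬝ᵥ (x - y)

/-- `q` multiplies all squared distances between points of `F` by one common factor, which may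
be zero. -/
def IsSimilarity {d : ℕ} {F : Finset (Fin d → ℤ)} (q : F → Fin d → ℤ) : Prop :=
  ∀ a b a' b' : F, sqDist (q a) (q b) * sqDist (a' : Fin d → ℤ) b' =
    sqDist (q a') (q b') * sqDist (a : Fin d → ℤ) b

/-- `g` is the restriction to `F` of a homothety with positive integer ratio. -/
def IsHomothety {d : ℕ} {F : Finset (Fin d → ℤ)} (g : F → Fin d → ℤ) : Prop :=
  ∃ (v : Fin d → ℤ) (l : ℤ), 0 < l ∧ ∀ a : F, g a = v + l • (a : Fin d → ℤ)

/-! ### Similarities and generic weighted sums -/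

section Similarity

variable {d : ℕ} {F : Finset (Fin d → ℤ)}

lemma sqDist_eq_zero {x y : Fin d → ℤ} : sqDist x y = 0 ↔ x = y := by
  rw [sqDist, dotProduct_self_eq_zero, sub_eq_zero]

lemma sqDist_smul_add (L : ℤ) (p p' x x' : Fin d → ℤ) :
    sqDist (L • p + x) (L • p' + x') =
      sqDist x x' + 2 * ((p - p') ⬝ᵥ (x - x')) * L + sqDist p p' * L ^ 2 := by
  have h : L • p + x - (L • p' + x') = L • (p - p') + (x - x') := by
    rw [smul_sub]; abel
  rw [sqDist, h, sqDist, sqDist]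
  simp only [dotProduct_add, add_dotProduct, smul_dotProduct, dotProduct_smul, smul_eq_mul]
  rw [dotProduct_comm (x - x') (p - p')]
  ring

lemma sqDist_comm (x y : Fin d → ℤ) : sqDist x y = sqDist y x := by
  simp only [sqDist, dotProduct, Pi.sub_apply]
  exact Finset.sum_congr rfl fun i _ => by ring

lemma IsSimilarity.const_of_eq {q : F → Fin d → ℤ} (hq : IsSimilarity q) {a b : F} (hab : a ≠ b)
    (h : q a = q b) (a' b' : F) : q a' = q b' := by
  have h1 := hq a b a' b'
  rw [sqDist_eq_zero.2 h, zero_mul] at h1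
  rcases mul_eq_zero.1 h1.symm with h2 | h2
  · exact sqDist_eq_zero.1 h2
  · exact absurd (Subtype.ext (sqDist_eq_zero.1 h2)) hab

lemma IsSimilarity.const_or_injective {q : F → Fin d → ℤ} (hq : IsSimilarity q) :
    (∀ a b, q a = q b) ∨ Function.Injective q := by
  by_cases h : Function.Injective q
  · exact Or.inr h
  · rw [Function.Injective] at h
    push Not at h
    obtain ⟨a, b, hab, hne⟩ := h
    exact Or.inl (hq.const_of_eq hne hab)

lemma IsHomothety.injective {g : F → Fin d → ℤ} (hg : IsHomothety g) : Function.Injective g := by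
  obtain ⟨v, l, hl, h⟩ := hg
  intro a b hab
  rw [h, h, add_right_inj] at hab
  exact Subtype.ext (smul_right_injective _ hl.ne' hab)

lemma isHomothety_sum {ι : Type*} [Fintype ι] {w : ι → ℤ} (hw : ∀ i, 0 < w i)
    {g : ι → F → Fin d → ℤ} {v : ι → Fin d → ℤ} {l : ι → ℤ} (hl : ∀ i, 0 ≤ l i)
    (hg : ∀ i a, g i a = v i + l i • (a : Fin d → ℤ)) {i₀ : ι} (hi₀ : 0 < l i₀) :
    IsHomothety (fun a => ∑ i, w i • g i a) := by
  refine ⟨∑ i, w i • v i, ∑ i, w i * l i, ?_, fun a => ?_⟩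
  · exact Finset.sum_pos' (fun i _ => mul_nonneg (hw i).le (hl i))
      ⟨i₀, Finset.mem_univ _, mul_pos (hw i₀) hi₀⟩
  · simp only [hg, smul_add, Finset.sum_add_distrib, Finset.sum_smul, mul_smul]

/-- Once `L` exceeds `|A| + |B|`, a nonzero leading term outweighs the rest; with `C = 0`, the
equality `|A| = |B| * L` forces `A = 0`. -/
lemma eventually_quadratic_eq_zero (A B C : ℤ) :
    ∀ᶠ L : ℤ in Filter.atTop, A + B * L + C * L ^ 2 = 0 → A = 0 ∧ C = 0 := by
  filter_upwards [Filter.eventually_ge_atTop (|A| + |B| + 1)] with L hL h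
  have hA := abs_nonneg A
  have hB := abs_nonneg B
  have h1 : C = 0 := by
    by_contra hC
    have h2 : |C * L ^ 2| = |A + B * L| := by
      rw [← abs_neg (A + B * L)]; congr 1; linarith
    have h3 : |A + B * L| ≤ |A| + |B| * L := by
      refine (abs_add_le _ _).trans ?_
      rw [abs_mul, abs_of_nonneg (by linarith : 0 ≤ L)]
    have h4 : L ^ 2 ≤ |C * L ^ 2| := by
      rw [abs_mul, abs_of_nonneg (sq_nonneg L)]
      exact le_mul_of_one_le_left (sq_nonneg L) (Int.one_le_abs hC)
    nlinarith
  subst h1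
  refine ⟨?_, rfl⟩
  by_contra hA0
  have h2 : |A| = |B| * L := by
    have h4 : A = -(B * L) := by linarith
    conv_lhs => rw [h4, abs_neg, abs_mul, abs_of_nonneg (by linarith : 0 ≤ L)]
  rcases hB.eq_or_lt with h3 | h3
  · rw [← h3, zero_mul] at h2
    exact hA0 (abs_eq_zero.1 h2)
  · nlinarith

/-- Generic weights: if a weighted sum of words over a finite alphabet of lattice points is a
similarity, then so is every single coordinate. -/
lemma exists_generic_weights (ι : Type*) [Fintype ι] (Q : Finset (Fin d → ℤ)) :
    ∃ w : ι → ℤ, (∀ i, 0 < w i) ∧ ∀ q : F → ι → Fin d → ℤ, (∀ a i, q a i ∈ Q) →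
      IsSimilarity (fun a => ∑ i, w i • q a i) → ∀ i, IsSimilarity (fun a => q a i) := by
  classical
  suffices H : ∀ s : Finset ι, ∃ w : ι → ℤ, (∀ i, 0 < w i) ∧ ∀ q : F → ι → Fin d → ℤ,
      (∀ a i, q a i ∈ Q) → IsSimilarity (fun a => ∑ i ∈ s, w i • q a i) →
      ∀ i ∈ s, IsSimilarity (fun a => q a i) by
    obtain ⟨w, hw, h⟩ := H Finset.univ
    exact ⟨w, hw, fun q hq hs i => h q hq hs i (Finset.mem_univ i)⟩
  intro s
  induction s using Finset.induction_on with
  | empty => exact ⟨1, fun _ => one_pos, fun _ _ _ i hi => absurd hi (Finset.notMem_empty i)⟩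
  | insert j s hj ih =>
    obtain ⟨w, hw, h⟩ := ih
    -- There are finitely many words over `Q` and quadruples in `F`, so one large `L` serves all.
    -- The similarity identity for `L • p + S` is quadratic in `L`; its leading and constant
    -- coefficients are the identities for `p` and `S`.
    have key : ∀ᶠ L : ℤ in Filter.atTop, ∀ (q : F → ι → Q) (a b a' b' : F),
        let S : F → Fin d → ℤ := fun a => ∑ i ∈ s, w i • (q a i : Fin d → ℤ)
        let p : F → Fin d → ℤ := fun a => q a j
        sqDist (L • p a + S a) (L • p b + S b) * sqDist (a' : Fin d → ℤ) b' =
          sqDist (L • p a' + S a') (L • p b' + S b') * sqDist (a : Fin d → ℤ) b →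
        sqDist (S a) (S b) * sqDist (a' : Fin d → ℤ) b' =
          sqDist (S a') (S b') * sqDist (a : Fin d → ℤ) b ∧
        sqDist (p a) (p b) * sqDist (a' : Fin d → ℤ) b' =
          sqDist (p a') (p b') * sqDist (a : Fin d → ℤ) b := by
      simp only [Filter.eventually_all]
      intro q a b a' b'
      set S : F → Fin d → ℤ := fun a => ∑ i ∈ s, w i • (q a i : Fin d → ℤ)
      set p : F → Fin d → ℤ := fun a => q a j
      filter_upwards [eventually_quadratic_eq_zero
        (sqDist (S a) (S b) * sqDist (a' : Fin d → ℤ) b' -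
          sqDist (S a') (S b') * sqDist (a : Fin d → ℤ) b)
        (2 * ((p a - p b) ⬝ᵥ (S a - S b)) * sqDist (a' : Fin d → ℤ) b' -
          2 * ((p a' - p b') ⬝ᵥ (S a' - S b')) * sqDist (a : Fin d → ℤ) b)
        (sqDist (p a) (p b) * sqDist (a' : Fin d → ℤ) b' -
          sqDist (p a') (p b') * sqDist (a : Fin d → ℤ) b)] with L hL hE
      rw [sqDist_smul_add, sqDist_smul_add] at hE
      have := hL (by linear_combination hE)
      exact ⟨sub_eq_zero.1 this.1, sub_eq_zero.1 this.2⟩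
    obtain ⟨L, hL, hL0⟩ := (key.and (Filter.eventually_gt_atTop 0)).exists
    refine ⟨Function.update w j L, fun i => ?_, fun q hq hs => ?_⟩
    · rcases eq_or_ne i j with rfl | hij
      · simpa using hL0
      · simpa [hij] using hw i
    · have hsum : ∀ a, ∑ i ∈ insert j s, Function.update w j L i • q a i =
          L • q a j + ∑ i ∈ s, w i • q a i := fun a => by
        rw [Finset.sum_insert hj, Function.update_self]
        congr 1
        exact Finset.sum_congr rfl fun i hi => by
          rw [Function.update_of_ne (ne_of_mem_of_not_mem hi hj)]
      simp only [hsum] at hs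
      have h2 := fun a b a' b' => hL (fun a i => ⟨q a i, hq a i⟩) a b a' b' (hs a b a' b')
      intro i hi
      rcases Finset.mem_insert.1 hi with rfl | hi
      · exact fun a b a' b' => (h2 a b a' b').2
      · exact h q hq (fun a b a' b' => (h2 a b a' b').1) i hi

/-- Send one point of `F` to `u` and all others to `u'`. The sums agree, so this is a degenerate
similarity, hence a similarity in each coordinate. Two of the at least three points share `u'`, so
every coordinate is constant. -/
lemma injOn_of_generic_weights (hF : 3 ≤ F.card) {ι : Type*} [Fintype ι] {Q : Finset (Fin d → ℤ)}
    {w : ι → ℤ} (hw : ∀ q : F → ι → Fin d → ℤ, (∀ a i, q a i ∈ Q) →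
      IsSimilarity (fun a => ∑ i, w i • q a i) → ∀ i, IsSimilarity (fun a => q a i))
    {u u' : ι → Fin d → ℤ} (hu : ∀ i, u i ∈ Q) (hu' : ∀ i, u' i ∈ Q)
    (h : ∑ i, w i • u i = ∑ i, w i • u' i) : u = u' := by
  classical
  obtain ⟨a, b, c, hab, hac, hbc⟩ := Fintype.two_lt_card_iff.1
    (show 2 < Fintype.card F by rw [Fintype.card_coe]; omega)
  have hs := hw (fun x => if x = a then u else u') (fun x i => by
      split_ifs
      exacts [hu i, hu' i]) (by
    have : ∀ x : F, ∑ i, w i • (if x = a then u else u') i = ∑ i, w i • u i := fun x => by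
      split_ifs
      exacts [rfl, h.symm]
    simp only [this]
    intro _ _ _ _
    simp [sqDist])
  funext i
  have := (hs i).const_of_eq hbc (by simp [hab.symm, hac.symm]) a b
  simpa [hab.symm] using this

end Similarity

/-! ### Pictures over a hypergraph -/

section Pictures

variable {d : ℕ} {F : Finset (Fin d → ℤ)} {V : Type*}

/-- `P` with the projection `π` is a picture over the hypergraph `E`: every non-constant similar
copy of `F` in `P` projects onto an edge. -/
def IsPicture (E : Set (F → V)) (P : Finset (Fin d → ℤ)) (π : (Fin d → ℤ) → V) : Prop :=
  ∀ q : F → Fin d → ℤ, (∀ a, q a ∈ P) → IsSimilarity q →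
    (∀ a b, q a = q b) ∨ ∃ e ∈ E, Set.range (π ∘ q) = Set.range e

/-- For every `r`-colouring the picture contains homothetic copies of `F` over all edges such that
the points of these copies over a vertex in `S` receive a colour depending only on the vertex. -/
def PictureArrow (r : ℕ) (E : Set (F → V)) (P : Finset (Fin d → ℤ)) (π : (Fin d → ℤ) → V)
    (S : Finset V) : Prop :=
  ∀ χ : (Fin d → ℤ) → Fin r, ∃ κ : V → Fin r, ∀ e ∈ E, ∃ g : F → Fin d → ℤ, IsHomothety g ∧
    ∀ a, g a ∈ P ∧ π (g a) = e a ∧ (e a ∈ S → χ (g a) = κ (e a))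

lemma exists_three (hF : 3 ≤ F.card) (a b : F) : ∃ c, c ≠ a ∧ c ≠ b := by
  classical
  have h : ({a, b} : Finset F).card < (Finset.univ : Finset F).card := by
    rw [Finset.card_univ, Fintype.card_coe]
    exact (Finset.card_le_two).trans_lt (by omega)
  obtain ⟨c, -, hc⟩ := Finset.exists_mem_notMem_of_card_lt_card h
  exact ⟨c, by simpa using hc⟩

lemma injective_of_range_eq {W : Type*} {e f : F → V} {s : V → W} (he : Function.Injective (s ∘ e))
    (h : Set.range f = Set.range e) : Function.Injective (s ∘ f) := by
  classical
  have h1 : Set.range (s ∘ f) = Set.range (s ∘ e) := by rw [Set.range_comp, h, Set.range_comp]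
  have h2 : (Finset.univ.image (s ∘ f)) = Finset.univ.image (s ∘ e) := by
    apply Finset.coe_injective
    rw [Finset.coe_image, Finset.coe_image, Finset.coe_univ, Set.image_univ, Set.image_univ, h1]
  have h3 : (Finset.univ.image (s ∘ f)).card = (Finset.univ : Finset F).card := by
    rw [h2, Finset.card_image_of_injective _ he]
  rw [← Set.injOn_univ, ← Finset.coe_univ]
  exact Finset.card_image_iff.1 h3

/-- Along an edge `s` takes `|F|` distinct values, so a copy lying over an edge cannot repeat an
`s`-value. A repetition therefore forces degeneracy. -/
lemma IsSimilarity.forall_eq_or_range_eq {E : Set (F → V)} {P : Finset (Fin d → ℤ)}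
    {π : (Fin d → ℤ) → V} {s : V → Fin d → ℤ} (hs : ∀ e ∈ E, IsHomothety (s ∘ e))
    (hP : IsPicture E P π) {q : F → Fin d → ℤ} (hq : IsSimilarity q) (hqP : ∀ a, q a ∈ P) {a b : F}
    (hab : a ≠ b) (h : s (π (q a)) = s (π (q b))) (a' b' : F) : q a' = q b' := by
  rcases hP q hqP hq with h1 | ⟨e, he, h1⟩
  · exact h1 a' b'
  · exact absurd (injective_of_range_eq (hs e he).injective h1 h) hab

/-- The starting picture: one copy of `F` for every edge, in general position. -/
lemma exists_picture_empty (hF : 3 ≤ F.card) [Finite V] [Nonempty V] (r : ℕ) (hr : 1 ≤ r)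
    (E : Set (F → V)) : ∃ (P : Finset (Fin d → ℤ)) (π : (Fin d → ℤ) → V),
      IsPicture E P π ∧ PictureArrow r E P π ∅ := by
  classical
  have := Fintype.ofFinite V
  have : Fintype E := Fintype.ofFinite E
  have hd : Nonempty (Fin d) := by
    by_contra hd
    rw [not_nonempty_iff] at hd
    have := Finset.card_le_one_of_subsingleton F
    omega
  -- Shifting by a point outside `F` makes every letter `f - g` nonzero, so a word vanishes exactly
  -- off the block of its own edge.
  obtain ⟨g, hg⟩ := F.exists_notMem
  let u : E × F → E → Fin d → ℤ := fun t e => if e = t.1 then (t.2 : Fin d → ℤ) - g else 0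
  let Q : Finset (Fin d → ℤ) := insert 0 (F.image (· - g))
  have huQ : ∀ t e, u t e ∈ Q := fun t e => by
    simp only [u, Q]
    split_ifs
    · exact Finset.mem_insert_of_mem (Finset.mem_image_of_mem _ t.2.2)
    · exact Finset.mem_insert_self _ _
  have hne : ∀ t : E × F, u t t.1 ≠ 0 := fun t h => by
    simp only [u, if_true, sub_eq_zero] at h
    exact hg (h ▸ t.2.2)
  have hu0 : ∀ t e, e ≠ t.1 → u t e = 0 := fun t e h => by simp only [u, if_neg h]
  obtain ⟨w, hw0, hw⟩ := exists_generic_weights (F := F) E Q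
  have hinj : Function.Injective u := fun t t' h => by
    have h1 : t.1 = t'.1 := by
      by_contra h1
      exact hne t (by rw [h]; exact hu0 _ _ h1)
    have h2 := congrFun h t.1
    simp only [u, if_true, h1] at h2
    exact Prod.ext h1 (Subtype.ext (sub_left_injective h2))
  let Φ : E × F → Fin d → ℤ := fun t => ∑ e, w e • u t e
  have hΦ : Function.Injective Φ := fun t t' h =>
    hinj (injOn_of_generic_weights hF hw (huQ t) (huQ t') h)
  let π : (Fin d → ℤ) → V := Function.extend Φ (fun t => (t.1 : F → V) t.2)
    fun _ => Classical.arbitrary V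
  have hπ : ∀ t, π (Φ t) = (t.1 : F → V) t.2 := fun t => hΦ.extend_apply _ _ _
  refine ⟨Finset.univ.image Φ, π, fun q hq hs => ?_, fun χ => ⟨fun _ => ⟨0, hr⟩, fun e he => ?_⟩⟩
  · have : ∀ a, ∃ t, Φ t = q a := fun a => by simpa using hq a
    choose t ht using this
    have hb : ∀ e, IsSimilarity fun a => u (t a) e :=
      hw (fun a => u (t a)) (fun a e => huQ _ _) (by rwa [← funext ht] at hs)
    refine or_iff_not_imp_left.2 fun hc => ?_
    -- If `a` and `b` lie in different blocks, a third point vanishes together with one of them in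
    -- the block of the other. That block is then constantly zero, although its own point is nonzero
    -- there.
    have hblock : ∀ a b, (t b).1 = (t a).1 := by
      by_contra hcon
      push Not at hcon
      obtain ⟨a, b, hab⟩ := hcon
      obtain ⟨c, hca, hcb⟩ := exists_three hF a b
      have hab' : a ≠ b := fun h => hab (by rw [h])
      have h1 : u (t b) (t a).1 = 0 := hu0 _ _ hab.symm
      have h2 : u (t a) (t b).1 = 0 := hu0 _ _ hab
      by_cases hc1 : (t c).1 = (t a).1
      · have h3 : u (t c) (t b).1 = 0 := hu0 _ _ (by rw [hc1]; exact hab)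
        exact hne (t b) (by
          rw [(hb (t b).1).const_of_eq hca (h3.trans h2.symm) b a, h2])
      · have h3 : u (t c) (t a).1 = 0 := hu0 _ _ (Ne.symm hc1)
        exact hne (t a) (by
          rw [(hb (t a).1).const_of_eq hcb (h3.trans h1.symm) a b, h1])
    push Not at hc
    obtain ⟨a₀, b₀, hab⟩ := hc
    have hi : Function.Injective fun a => u (t a) (t a₀).1 := by
      rcases (hb (t a₀).1).const_or_injective with h | h
      · refine absurd ?_ hab
        rw [← ht, ← ht]
        congr 1
        refine hinj (funext fun e => ?_)
        by_cases he : e = (t a₀).1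
        · rw [he]; exact h a₀ b₀
        · rw [hu0 _ _ he, hu0 _ _ (by rw [hblock a₀ b₀]; exact he)]
      · exact h
    have hsurj : Function.Surjective fun a => (t a).2 := by
      apply Finite.surjective_of_injective
      intro a b h
      apply hi
      have : t a = t b := Prod.ext (hblock b a) h
      simp only [this]
    refine ⟨(t a₀).1, (t a₀).1.2, ?_⟩
    have : π ∘ q = ((t a₀).1 : F → V) ∘ fun a => (t a).2 := by
      funext a
      simp only [Function.comp_apply, ← ht, hπ, hblock a₀ a]
    rw [this, hsurj.range_comp]
  · refine ⟨fun a => Φ (⟨e, he⟩, a), ?_, fun a => ⟨?_, hπ _, by simp⟩⟩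
    · refine isHomothety_sum hw0 (g := fun i a => u (⟨e, he⟩, a) i)
        (v := fun i => if i = ⟨e, he⟩ then -g else 0) (l := fun i => if i = ⟨e, he⟩ then 1 else 0)
        (fun i => ?_) (fun i a => ?_) (i₀ := ⟨e, he⟩) (by simp)
      · split_ifs <;> simp
      · simp only [u]; split_ifs
        · rw [one_smul]; abel
        · simp
    · exact Finset.mem_image_of_mem _ (Finset.mem_univ _)

end Pictures

/-! ### Partite amalgamation along Hales–Jewett lines -/

section Amalgamation

open Combinatorics

variable {d : ℕ} {F : Finset (Fin d → ℤ)} {V : Type*}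

lemma finite_line (α ι : Type*) [Finite α] [Finite ι] : Finite (Line α ι) := by
  refine Finite.of_injective (fun l : Line α ι => l.idxFun) ?_
  rintro ⟨f, hf⟩ ⟨g, hg⟩ h
  simpa using h

/-- The word of `p` in the copy belonging to the combinatorial line `l`: the coordinates in `ι`
carry `p` at the active coordinates of `l` and the letter of `l` elsewhere; among the other
coordinates only the one indexed by `l` may be nonzero. -/
def copyWord {A : Set (Fin d → ℤ)} {ι : Type*} [DecidableEq (Line A ι)]
    (h : (Fin d → ℤ) → Fin d → ℤ) (l : Line A ι) (p : Fin d → ℤ) : ι ⊕ Line A ι → Fin d → ℤ :=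
  Sum.elim (fun i => (l.idxFun i).elim p (fun v => v)) (fun m => if m = l then h p else 0)

section copyWord

variable {A : Set (Fin d → ℤ)} {ι : Type*} [DecidableEq (Line A ι)]
    (h : (Fin d → ℤ) → Fin d → ℤ) {l m : Line A ι} (p : Fin d → ℤ)

lemma copyWord_active {i : ι} (hi : l.idxFun i = none) : copyWord h l p (Sum.inl i) = p := by
  simp [copyWord, hi]

lemma copyWord_fixed {i : ι} {v : A} (hi : l.idxFun i = some v) :
    copyWord h l p (Sum.inl i) = v := by
  simp [copyWord, hi]

lemma copyWord_self : copyWord h l p (Sum.inr l) = h p := by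
  simp [copyWord]

lemma copyWord_ne (hm : m ≠ l) : copyWord h l p (Sum.inr m) = 0 := by
  simp [copyWord, hm]

lemma copyWord_eq_or_mem (i : ι) :
    copyWord h l p (Sum.inl i) = p ∨ copyWord h l p (Sum.inl i) ∈ A := by
  rcases hi : l.idxFun i with _ | v
  · exact Or.inl (copyWord_active h p hi)
  · rw [copyWord_fixed h p hi]
    exact Or.inr v.2

/-- Points over the vertex being treated have `h = 0`, so the coordinate marking the line
disappears. Copies for different lines are thus glued along the words in `A`, which are what
Hales–Jewett colours. -/
lemma copyWord_of_eq_zero {v : A} (hv : h v = 0) :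
    copyWord h l v = Sum.elim (fun i => ((l v i : A) : Fin d → ℤ)) 0 := by
  funext j
  rcases j with i | m
  · rcases hi : l.idxFun i with _ | v' <;> simp [copyWord, hi]
  · simp [copyWord, hv]

end copyWord

/-- Similar copies of `F` among the words of the amalgamated picture project onto edges. -/
lemma copyWord_isPicture (hF : 3 ≤ F.card) {s : V → Fin d → ℤ} {E : Set (F → V)}
    (hs : ∀ e ∈ E, IsHomothety (s ∘ e)) {P : Finset (Fin d → ℤ)} {π : (Fin d → ℤ) → V}
    (hP : IsPicture E P π) {x : V} {ι : Type*} {A : Set (Fin d → ℤ)}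
    [DecidableEq (Line A ι)] (hA : ∀ p ∈ A, p ∈ P ∧ π p = x)
    (l : F → Line A ι) (p : F → Fin d → ℤ) (hp : ∀ a, p a ∈ P)
    (hsim : ∀ j, IsSimilarity fun a => copyWord (fun p => s (π p) - s x) (l a) (p a) j) :
    (∀ a b j, copyWord (fun p => s (π p) - s x) (l a) (p a) j =
      copyWord (fun p => s (π p) - s x) (l b) (p b) j) ∨
    ∃ e ∈ E, Set.range (π ∘ p) = Set.range e := by
  set h : (Fin d → ℤ) → Fin d → ℤ := fun p => s (π p) - s x with hh
  set u : F → ι ⊕ Line A ι → Fin d → ℤ := fun a => copyWord h (l a) (p a) with hu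
  have huP : ∀ a i, u a (Sum.inl i) ∈ P := fun a i => by
    rcases copyWord_eq_or_mem h (l := l a) (p a) i with h1 | h1
    · simp only [hu, h1, hp]
    · exact (hA _ h1).1
  have hconst : ∀ (i : ι) {a b : F}, a ≠ b →
      s (π (u a (Sum.inl i))) = s (π (u b (Sum.inl i))) →
      ∀ a b, u a (Sum.inl i) = u b (Sum.inl i) := fun i a b hab h1 =>
    (hsim (Sum.inl i)).forall_eq_or_range_eq hs hP (fun a => huP a i) hab h1
  have hself : ∀ a, u a (Sum.inr (l a)) = h (p a) := fun a => copyWord_self h _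
  have hnot : ∀ a m, m ≠ l a → u a (Sum.inr m) = 0 := fun a m hm => copyWord_ne h _ hm
  -- Here every `ι`-coordinate has constant `s`-value `s x`, so the picture property makes it
  -- constant.
  by_cases hz : ∀ a, h (p a) = 0
  · left
    have hz' : ∀ a i, s (π (u a (Sum.inl i))) = s x := fun a i => by
      rcases copyWord_eq_or_mem h (l := l a) (p a) i with h1 | h1
      · simp only [hu, h1]
        exact sub_eq_zero.1 (hz a)
      · rw [(hA _ h1).2]
    rintro a b (i | m)
    · obtain ⟨c, hc, -⟩ := exists_three hF a b
      exact hconst i hc ((hz' _ i).trans (hz' _ i).symm) a b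
    · have h0 : ∀ a, u a (Sum.inr m) = 0 := fun a => by
        by_cases hm : m = l a
        · rw [hm, hself, hz]
        · exact hnot a m hm
      exact (h0 a).trans (h0 b).symm
  push Not at hz
  obtain ⟨a, ha⟩ := hz
  -- The coordinate of `l a` is nonzero at `a`. If constant, all points use the line `l a` and have
  -- equal `s`-values, so the copy degenerates. If injective, at most one point can use another
  -- line, since such points all vanish there.
  rcases (hsim (Sum.inr (l a))).const_or_injective with hc | hinj
  · left
    have hl : ∀ b, l b = l a := fun b => by
      by_contra hb
      have h1 : u a (Sum.inr (l a)) = u b (Sum.inr (l a)) := hc a b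
      rw [hself, hnot b _ (Ne.symm hb)] at h1
      exact ha h1
    have hz : ∀ b c, s (π (p b)) = s (π (p c)) := fun b c => by
      have h1 : u b (Sum.inr (l a)) = u c (Sum.inr (l a)) := hc b c
      rw [← hl b, hself, hl b, ← hl c, hself] at h1
      exact sub_left_injective h1
    rintro b c (i | m)
    · rcases hi : (l a).idxFun i with _ | v
      · have h2 : ∀ b, u b (Sum.inl i) = p b := fun b =>
          copyWord_active h _ (by rw [hl b, hi])
        obtain ⟨b', hb', -⟩ := exists_three hF b c
        exact hconst i hb' (by rw [h2, h2]; exact hz _ _) b c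
      · have h2 : ∀ b, u b (Sum.inl i) = v := fun b =>
          copyWord_fixed h _ (by rw [hl b, hi])
        exact (h2 b).trans (h2 c).symm
    · by_cases hm : m = l a
      · rw [hm]; exact hc b c
      · exact (hnot b m (by rwa [hl b])).trans (hnot c m (by rwa [hl c])).symm
  right
  have hinj' : ∀ b c, u b (Sum.inr (l a)) = u c (Sum.inr (l a)) → b = c := fun b c h => hinj h
  have hl : ∀ b, h (p b) ≠ 0 → l b = l a := fun b hb => by
    by_contra hlb
    have hab : a ≠ b := fun h => hlb (by rw [h])
    obtain ⟨c, hca, hcb⟩ := exists_three hF a b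
    have hlc : l c = l a := by
      by_contra hlc
      exact hcb (hinj' c b (by rw [hnot c _ (Ne.symm hlc), hnot b _ (Ne.symm hlb)]))
    have h1 := (hsim (Sum.inr (l b))).const_of_eq hca
      (show u c (Sum.inr (l b)) = u a (Sum.inr (l b)) by
        rw [hnot c _ (by rwa [hlc]), hnot a _ hlb]) b a
    have h2 : u b (Sum.inr (l b)) = u a (Sum.inr (l b)) := h1
    rw [hself, hnot a _ hlb] at h2
    exact hb h2
  obtain ⟨i₀, hi₀⟩ := (l a).proper
  -- It remains to find one `ι`-coordinate with the same projection as `p`; the picture property of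
  -- `P` there supplies the edge.
  obtain ⟨i, hi⟩ : ∃ i, ∀ b, π (u b (Sum.inl i)) = π (p b) := by
    by_cases hall : ∀ b, l b = l a
    · exact ⟨i₀, fun b => by rw [hu]; dsimp only; rw [copyWord_active h _ (by rw [hall, hi₀])]⟩
    push Not at hall
    obtain ⟨c, hc⟩ := hall
    have hothers : ∀ b, b ≠ c → l b = l a := fun b hbc => by
      by_contra hb
      exact hbc (hinj' b c (by rw [hnot b _ (Ne.symm hb), hnot c _ (Ne.symm hc)]))
    -- If the stray point `c` is over `x`, its letter is over `x` in every coordinate, so any active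
    -- coordinate of `l a` works. Otherwise take an active coordinate of `l c`: were it fixed in `l
    -- a`, all other points would share a letter of `A`, forcing `p c` to be that letter and so to
    -- lie over `x`.
    by_cases hcx : π (p c) = x
    · refine ⟨i₀, fun b => ?_⟩
      by_cases hbc : b = c
      · subst hbc
        rcases copyWord_eq_or_mem h (l := l b) (p b) i₀ with h1 | h1
        · simp only [hu, h1]
        · rw [hcx]
          exact (hA _ h1).2
      · rw [hu]; dsimp only
        rw [copyWord_active h _ (by rw [hothers b hbc, hi₀])]
    · obtain ⟨i₁, hi₁⟩ := (l c).proper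
      refine ⟨i₁, fun b => ?_⟩
      rcases hv : (l a).idxFun i₁ with _ | v
      · rw [hu]; dsimp only
        rw [copyWord_active h]
        by_cases hbc : b = c
        · rw [hbc, hi₁]
        · rw [hothers b hbc, hv]
      · exfalso
        have h1 : ∀ b, b ≠ c → u b (Sum.inl i₁) = v := fun b hbc =>
          copyWord_fixed h _ (by rw [hothers b hbc, hv])
        obtain ⟨b₁, hb₁, -⟩ := exists_three hF c c
        obtain ⟨b₂, hb₂, hb₂'⟩ := exists_three hF c b₁
        have h2 : u c (Sum.inl i₁) = u b₁ (Sum.inl i₁) :=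
          (hsim (Sum.inl i₁)).const_of_eq hb₂' (show u b₂ (Sum.inl i₁) = u b₁ (Sum.inl i₁) by
            rw [h1 _ hb₁, h1 _ hb₂]) c b₁
        have h3 : u c (Sum.inl i₁) = p c := copyWord_active h _ hi₁
        rw [h1 _ hb₁, h3] at h2
        exact hcx (h2 ▸ (hA _ v.2).2)
  rcases hP (fun b => u b (Sum.inl i)) (fun b => huP b i) (hsim (Sum.inl i)) with hc | ⟨e, he, h1⟩
  · exfalso
    obtain ⟨b, hb, -⟩ := exists_three hF a a
    have hz : π (p b) = π (p a) := by rw [← hi, ← hi]; exact congrArg π (hc b a)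
    have hlb : l b = l a := hl b (by rw [hh]; dsimp only; rw [hz]; exact ha)
    refine hb (hinj' b a ?_)
    conv_lhs => rw [← hlb, hself]
    rw [hself, hh]
    dsimp only
    rw [hz]
  · refine ⟨e, he, ?_⟩
    rw [← h1]
    congr 1
    exact funext fun b => (hi b).symm

lemma exists_picture_insert (hF : 3 ≤ F.card) {r : ℕ} {s : V → Fin d → ℤ}
    {E : Set (F → V)} (hs : ∀ e ∈ E, IsHomothety (s ∘ e)) [DecidableEq V]
    {P : Finset (Fin d → ℤ)} {π : (Fin d → ℤ) → V} {S : Finset V}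
    (hP : IsPicture E P π) (hR : PictureArrow r E P π S) (x : V) :
    ∃ (P' : Finset (Fin d → ℤ)) (π' : (Fin d → ℤ) → V),
      IsPicture E P' π' ∧ PictureArrow r E P' π' (insert x S) := by
  classical
  let A : Set (Fin d → ℤ) := {p | p ∈ P ∧ π p = x}
  have : Finite A := P.finite_toSet.subset (fun p hp => hp.1)
  obtain ⟨ι, _, hι⟩ := Line.exists_mono_in_high_dimension A (Fin r)
  have := finite_line A ι
  have := Fintype.ofFinite (Line A ι)
  let h : (Fin d → ℤ) → Fin d → ℤ := fun p => s (π p) - s x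
  let Q : Finset (Fin d → ℤ) := P ∪ insert 0 (P.image h)
  have huQ : ∀ (l : Line A ι), ∀ p ∈ P, ∀ j, copyWord h l p j ∈ Q := by
    rintro l p hp (i | m)
    · apply Finset.mem_union_left
      rcases copyWord_eq_or_mem h (l := l) p i with h1 | h1
      · rwa [h1]
      · exact h1.1
    · apply Finset.mem_union_right
      by_cases hm : m = l
      · rw [hm, copyWord_self]
        exact Finset.mem_insert_of_mem (Finset.mem_image_of_mem _ hp)
      · rw [copyWord_ne h p hm]
        exact Finset.mem_insert_self _ _
  obtain ⟨w, hw0, hw⟩ := exists_generic_weights (F := F) (ι ⊕ Line A ι) Q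
  let Φ : Line A ι × P → Fin d → ℤ := fun t => ∑ j, w j • copyWord h t.1 t.2 j
  -- `Φ` need not be injective, because copies are glued over `x`. The projection is still well
  -- defined: equal words come from equal points or from points over `x`.
  have hfac : Function.FactorsThrough (fun t : Line A ι × P => π t.2) Φ := by
    rintro ⟨l, p, hp⟩ ⟨l', p', hp'⟩ heq
    have h1 := injOn_of_generic_weights hF hw (huQ l p hp) (huQ l' p' hp') heq
    have key : ∀ (l l' : Line A ι) (p p' : Fin d → ℤ), copyWord h l p = copyWord h l' p' →
        p = p' ∨ π p = x := fun l l' p p' h1 => by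
      obtain ⟨i, hi⟩ := l.proper
      have h2 := congrFun h1 (Sum.inl i)
      rw [copyWord_active h p hi] at h2
      rcases copyWord_eq_or_mem h (l := l') p' i with h3 | h3
      · exact Or.inl (h2.trans h3)
      · rw [h2]
        exact Or.inr h3.2
    dsimp only
    rcases key l l' p p' h1 with h2 | h2
    · rw [h2]
    · rcases key l' l p' p h1.symm with h3 | h3
      · rw [h3]
      · rw [h2, h3]
  let π' : (Fin d → ℤ) → V := Function.extend Φ (fun t => π t.2) fun _ => x
  have hπ' : ∀ t, π' (Φ t) = π t.2 := fun t => hfac.extend_apply _ t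
  refine ⟨Finset.univ.image Φ, π', fun q hq hsim => ?_, fun χ => ?_⟩
  · have : ∀ a, ∃ t, Φ t = q a := fun a => by simpa using hq a
    choose t ht using this
    have hb := hw (fun a => copyWord h (t a).1 (t a).2) (fun a => huQ _ _ (t a).2.2)
      (by rwa [← funext ht] at hsim)
    rcases copyWord_isPicture hF hs hP (fun p hp => hp)
      (fun a => (t a).1) (fun a => (t a).2) (fun a => (t a).2.2) hb with h1 | ⟨e, he, h1⟩
    · left
      intro a b
      rw [← ht, ← ht]
      exact Finset.sum_congr rfl fun j _ => by rw [h1 a b j]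
    · refine Or.inr ⟨e, he, ?_⟩
      rw [← h1]
      congr 1
      funext a
      simp only [Function.comp_apply, ← ht, hπ']
  · obtain ⟨l, c, hl⟩ := hι fun v => χ (∑ j : ι ⊕ Line A ι, w j • (Sum.elim
      (fun i => ((v i : A) : Fin d → ℤ)) 0 : ι ⊕ Line A ι → Fin d → ℤ) j)
    -- The monochromatic line fixes the colour over `x`; the old arrow property is applied to the
    -- copy of `P` carried by that same line, handling the vertices of `S`.
    obtain ⟨κ, hκ⟩ := hR fun p => χ (∑ j, w j • copyWord h l p j)
    refine ⟨Function.update κ x c, fun e he => ?_⟩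
    obtain ⟨g, ⟨v, m, hm, hg⟩, hge⟩ := hκ e he
    refine ⟨fun a => ∑ j, w j • copyWord h l (g a) j, ?_, fun a => ⟨?_, ?_, fun hea => ?_⟩⟩
    · obtain ⟨v', m', hm', hs'⟩ := hs e he
      obtain ⟨i₀, hi₀⟩ := l.proper
      refine isHomothety_sum hw0 (g := fun j a => copyWord h l (g a) j)
        (v := Sum.elim (fun i => (l.idxFun i).elim v (fun y => y))
          (fun k => if k = l then v' - s x else 0))
        (l := Sum.elim (fun i => (l.idxFun i).elim m (fun _ => 0))
          (fun k => if k = l then m' else 0)) ?_ ?_ (i₀ := Sum.inl i₀) (by simpa [hi₀] using hm)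
      · rintro (i | k)
        · rcases hi : l.idxFun i with _ | y <;> simp [hi, hm.le]
        · simp only [Sum.elim_inr]
          split_ifs
          exacts [hm'.le, le_rfl]
      · rintro (i | k) a
        · rcases hi : l.idxFun i with _ | y <;> simp [copyWord, hi, hg]
        · have h1 : s (π (g a)) = v' + m' • (a : Fin d → ℤ) := by
            rw [(hge a).2.1]; exact hs' a
          simp only [copyWord, Sum.elim_inr, h, h1]
          split_ifs
          · abel
          · simp
    · exact Finset.mem_image_of_mem Φ (Finset.mem_univ (l, ⟨g a, (hge a).1⟩))
    · exact (hπ' (l, ⟨g a, (hge a).1⟩)).trans (hge a).2.1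
    · by_cases hx : e a = x
      · rw [hx, Function.update_self]
        have hgA : g a ∈ A := ⟨(hge a).1, (hge a).2.1.trans hx⟩
        rw [← hl ⟨g a, hgA⟩]
        congr 1
        have := copyWord_of_eq_zero h (l := l) (v := ⟨g a, hgA⟩)
          (by simp only [h, hgA.2, sub_self])
        rw [← this]
      · rw [Function.update_of_ne hx]
        exact (hge a).2.2 (Finset.mem_of_mem_insert_of_ne hea hx)

lemma exists_picture_univ (hF : 3 ≤ F.card) [Fintype V] [Nonempty V] {r : ℕ} (hr : 1 ≤ r)
    {s : V → Fin d → ℤ} {E : Set (F → V)} (hs : ∀ e ∈ E, IsHomothety (s ∘ e)) :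
    ∃ (P : Finset (Fin d → ℤ)) (π : (Fin d → ℤ) → V),
      IsPicture E P π ∧ PictureArrow r E P π Finset.univ := by
  classical
  suffices H : ∀ S : Finset V, ∃ (P : Finset (Fin d → ℤ)) (π : (Fin d → ℤ) → V),
      IsPicture E P π ∧ PictureArrow r E P π S from H _
  intro S
  induction S using Finset.induction_on with
  | empty => exact exists_picture_empty hF r hr E
  | insert x S _ ih =>
    obtain ⟨P, π, hP, hR⟩ := ih
    exact exists_picture_insert hF hs hP hR x

end Amalgamation

/-! ### Finite Ramsey theorem -/

section Ramsey

/-- Set the minimum of `S` aside, make the colour of sets containing it constant using the case `m`,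
and continue inside the homogeneous set. Colours then depend only on the least element. -/
lemma exists_end_homogeneous {r m : ℕ}
    (hm : ∀ T, ∃ N, ∀ S : Finset ℕ, N ≤ S.card → ∀ χ : Finset ℕ → Fin r,
      ∃ U ⊆ S, U.card = T ∧ ∃ c, ∀ A ⊆ U, A.card = m → χ A = c) (L : ℕ) :
    ∃ N, ∀ S : Finset ℕ, N ≤ S.card → ∀ χ : Finset ℕ → Fin r, ∃ U ⊆ S, U.card = L ∧
      ∃ g : ℕ → Fin r, ∀ A ⊆ U, A.card = m + 1 → ∀ x ∈ A, (∀ y ∈ A, x ≤ y) → χ A = g x := by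
  induction L with
  | zero =>
    refine ⟨0, fun S _ χ => ⟨∅, Finset.empty_subset _, rfl, fun _ => χ ∅, fun A hA hc => ?_⟩⟩
    rw [Finset.subset_empty.1 hA] at hc
    simp at hc
  | succ L ih =>
    obtain ⟨N, hN⟩ := ih
    obtain ⟨M, hM⟩ := hm N
    refine ⟨M + 1, fun S hS χ => ?_⟩
    have hne : S.Nonempty := Finset.card_pos.1 (by omega)
    set x := S.min' hne
    have hx : x ∈ S := S.min'_mem hne
    obtain ⟨U', hU', hc', c, hc⟩ := hM (S.erase x) (by rw [Finset.card_erase_of_mem hx]; omega)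
      fun B => χ (insert x B)
    obtain ⟨U, hU, hcU, g, hg⟩ := hN U' hc'.ge χ
    have hxU : ∀ y ∈ U, x < y := fun y hy => by
      have := hU' (hU hy)
      exact lt_of_le_of_ne (S.min'_le y (Finset.mem_of_mem_erase this))
        (Finset.ne_of_mem_erase this).symm
    have hxU' : x ∉ U := fun h => lt_irrefl _ (hxU x h)
    refine ⟨insert x U, ?_, by rw [Finset.card_insert_of_notMem hxU', hcU],
      Function.update g x c, fun A hA hAc y hy hmin => ?_⟩
    · exact Finset.insert_subset hx ((hU.trans hU').trans (Finset.erase_subset _ _))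
    · by_cases hxA : x ∈ A
      · have hyx : y = x := by
          by_contra hne
          exact absurd (hmin x hxA)
            (not_le.2 (hxU y ((Finset.mem_insert.1 (hA hy)).resolve_left hne)))
        rw [hyx, Function.update_self, ← Finset.insert_erase hxA]
        refine hc _ (fun z hz => hU ?_) ?_
        · rw [Finset.mem_erase] at hz
          exact (Finset.mem_insert.1 (hA hz.2)).resolve_left hz.1
        · rw [Finset.card_erase_of_mem hxA, hAc]; rfl
      · rw [Function.update_of_ne (ne_of_mem_of_not_mem hy hxA)]
        refine hg A (fun z hz => ?_) hAc y hy hmin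
        exact (Finset.mem_insert.1 (hA hz)).resolve_left (ne_of_mem_of_not_mem hz hxA)

/-- The finite Ramsey theorem for colourings of `m`-element sets of natural numbers. -/
theorem exists_homogeneous (r m T : ℕ) :
    ∃ N, ∀ S : Finset ℕ, N ≤ S.card → ∀ χ : Finset ℕ → Fin r,
      ∃ U ⊆ S, U.card = T ∧ ∃ c, ∀ A ⊆ U, A.card = m → χ A = c := by
  induction m generalizing T with
  | zero =>
    refine ⟨T, fun S hS χ => ?_⟩
    obtain ⟨U, hU, hc⟩ := Finset.exists_subset_card_eq hS
    exact ⟨U, hU, hc, χ ∅, fun A _ hA => by rw [Finset.card_eq_zero.1 hA]⟩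
  | succ m ih =>
    obtain ⟨N, hN⟩ := exists_end_homogeneous ih (r * T)
    refine ⟨N, fun S hS χ => ?_⟩
    obtain ⟨U, hU, hc, g, hg⟩ := hN S hS χ
    obtain ⟨c, -, hcT⟩ := Finset.exists_le_card_fiber_of_mul_le_card_of_maps_to
      (f := g) (s := U) (t := Finset.univ) (n := T) (fun _ _ => Finset.mem_univ _)
      ⟨χ ∅, Finset.mem_univ _⟩ (by simp [hc])
    obtain ⟨U', hU', hc'⟩ := Finset.exists_subset_card_eq hcT
    have hsub : U' ⊆ U := hU'.trans (Finset.filter_subset _ _)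
    refine ⟨U', hsub.trans hU, hc', c, fun A hA hAc => ?_⟩
    have hne : A.Nonempty := Finset.card_pos.1 (by omega)
    rw [hg A (hA.trans hsub) hAc _ (A.min'_mem hne) fun y hy => A.min'_le y hy]
    exact (Finset.mem_filter.1 (hU' (hA (A.min'_mem hne)))).2

end Ramsey

/-! ### The shift hypergraph and peak positions -/

section Shift

variable {m k N : ℕ}

/-- The window of length `m` starting at position `j` of a sequence. -/
def window (U : Fin (m + k) ↪ Fin N) (j : Fin k) : Fin m ↪ Fin N where
  toFun t := U ⟨t + j, by omega⟩
  inj' a b h := by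
    have := U.injective h
    simp only [Fin.mk.injEq] at this
    exact Fin.ext (by omega)

lemma window_apply (U : Fin (m + k) ↪ Fin N) (j : Fin k) (t : Fin m) :
    window U j t = U ⟨t + j, by omega⟩ := rfl

lemma exists_mono_windows (r m k : ℕ) (hr : 1 ≤ r) : ∃ N, ∀ χ : (Fin m ↪ Fin N) → Fin r,
    ∃ (U : Fin (m + k) ↪ Fin N) (c : Fin r), ∀ j, χ (window U j) = c := by
  classical
  obtain ⟨N, hN⟩ := exists_homogeneous r m (m + k)
  refine ⟨N, fun χ => ?_⟩
  let ω : ∀ A : Finset ℕ, A.card = m ∧ A ⊆ Finset.range N → (Fin m ↪ Fin N) := fun A h =>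
    ⟨fun t => ⟨A.orderEmbOfFin h.1 t, Finset.mem_range.1 (h.2 (A.orderEmbOfFin_mem h.1 t))⟩,
      fun a b hab => (A.orderEmbOfFin h.1).injective (by simpa using hab)⟩
  obtain ⟨S, hS, hc, c, hχ⟩ := hN (Finset.range N) (by simp) fun A =>
    if h : A.card = m ∧ A ⊆ Finset.range N then χ (ω A h) else ⟨0, hr⟩
  refine ⟨⟨fun t => ⟨S.orderEmbOfFin hc t, Finset.mem_range.1 (hS (S.orderEmbOfFin_mem hc t))⟩,
    fun a b hab => (S.orderEmbOfFin hc).injective (by simpa using hab)⟩, c, fun j => ?_⟩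
  let f : Fin m → ℕ := fun t => S.orderEmbOfFin hc ⟨t + j, by omega⟩
  have hf : StrictMono f := fun a b hab =>
    (S.orderEmbOfFin hc).strictMono (Fin.lt_def.2 (Nat.add_lt_add_right (Fin.lt_def.1 hab) _))
  have hfS : Finset.univ.image f ⊆ S := fun y hy => by
    obtain ⟨t, -, rfl⟩ := Finset.mem_image.1 hy
    exact S.orderEmbOfFin_mem hc _
  have hfc : (Finset.univ.image f).card = m := by
    rw [Finset.card_image_of_injective _ hf.injective, Finset.card_univ, Fintype.card_fin]
  have h1 := hχ _ hfS hfc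
  rw [dif_pos ⟨hfc, hfS.trans hS⟩] at h1
  rw [← h1]
  congr 1
  ext t
  exact congrFun (Finset.orderEmbOfFin_unique hfc
    (fun t => Finset.mem_image_of_mem f (Finset.mem_univ t)) hf) t

/-- The sequence `W` takes its largest value with respect to `σ` at a position which is far from
both ends and not divisible by `k`. -/
def PeakGood (m k N : ℕ) (σ : Equiv.Perm (Fin N)) (W : Fin m ↪ Fin N) : Prop :=
  ∃ t : Fin m, (∀ t', σ (W t') ≤ σ (W t)) ∧ k ≤ (t : ℕ) ∧ (t : ℕ) + k ≤ m ∧ ¬ k ∣ (t : ℕ)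

/-- If all windows were good, the margins of length `k` would make them share one peak of `U`. Its
position `t₀` in the first window becomes `t₀ - t₀ % k` in the window starting at `t₀ % k`, a
multiple of `k`. -/
lemma exists_not_peakGood (hk : 0 < k) (σ : Equiv.Perm (Fin N)) (U : Fin (m + k) ↪ Fin N) :
    ∃ j, ¬ PeakGood m k N σ (window U j) := by
  by_contra! hall
  obtain ⟨t₀, h₀, h1₀, h2₀, -⟩ := hall ⟨0, hk⟩
  obtain ⟨t, h, h1, h2, h3⟩ := hall ⟨t₀ % k, Nat.mod_lt _ hk⟩
  have hlt := Nat.mod_lt (t₀ : ℕ) hk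
  have hle := Nat.mod_le (t₀ : ℕ) k
  have e1 := h₀ ⟨t + t₀ % k, by omega⟩
  have e2 := h ⟨t₀ - t₀ % k, by omega⟩
  simp only [window_apply, add_zero] at e1 e2
  have e3 : (⟨(t₀ - t₀ % k : ℕ) + t₀ % k, by omega⟩ : Fin (m + k)) = ⟨t₀, by omega⟩ :=
    Fin.ext (by simp only; omega)
  rw [e3] at e2
  have e4 := U.injective (σ.injective (le_antisymm e1 e2))
  simp only [Fin.mk.injEq] at e4
  apply h3
  have : (t : ℕ) = t₀ - t₀ % k := by omega
  rw [this]
  exact Nat.dvd_sub_mod _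

lemma card_peakGood (hm : 0 < m) (W : Fin m ↪ Fin N) [DecidablePred fun σ => PeakGood m k N σ W]
    [DecidablePred fun t : Fin m => k ≤ (t : ℕ) ∧ (t : ℕ) + k ≤ m ∧ ¬ k ∣ (t : ℕ)] :
    m * (Finset.univ.filter fun σ => PeakGood m k N σ W).card =
      (Finset.univ.filter fun t : Fin m => k ≤ (t : ℕ) ∧ (t : ℕ) + k ≤ m ∧ ¬ k ∣ (t : ℕ)).card *
        Fintype.card (Equiv.Perm (Fin N)) := by
  classical
  have hmax : ∀ σ : Equiv.Perm (Fin N), ∃ t, ∀ t', σ (W t') ≤ σ (W t) := fun σ => by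
    have : Nonempty (Fin m) := ⟨⟨0, hm⟩⟩
    exact Finite.exists_max fun t => σ (W t)
  choose τ hτ using hmax
  have huniq : ∀ σ t, (∀ t', σ (W t') ≤ σ (W t)) ↔ τ σ = t := fun σ t => by
    constructor
    · exact fun h => W.injective (σ.injective (le_antisymm (h _) (hτ σ _)))
    · rintro rfl
      exact hτ σ
  have hgood : ∀ σ, PeakGood m k N σ W ↔ τ σ ∈
      Finset.univ.filter fun t : Fin m => k ≤ (t : ℕ) ∧ (t : ℕ) + k ≤ m ∧ ¬ k ∣ (t : ℕ) := by
    intro σ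
    simp only [PeakGood, huniq, Finset.mem_filter, Finset.mem_univ, true_and, exists_eq_left']
  set G := Finset.univ.filter fun t : Fin m => k ≤ (t : ℕ) ∧ (t : ℕ) + k ≤ m ∧ ¬ k ∣ (t : ℕ)
  let t₀ : Fin m := ⟨0, hm⟩
  have hcard : ∀ t, (Finset.univ.filter fun σ => τ σ = t).card =
      (Finset.univ.filter fun σ => τ σ = t₀).card := fun t => by
    -- Composing `σ` with a transposition of two entries of `W` exchanges the corresponding peak
    -- positions, so the peak is uniformly distributed.
    refine Finset.card_equiv (Equiv.mulRight (Equiv.swap (W t) (W t₀))) fun σ => ?_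
    simp only [Finset.mem_filter, Finset.mem_univ, true_and, ← huniq, Equiv.coe_mulRight,
      Equiv.Perm.mul_apply, Equiv.swap_apply_right]
    have hsw : ∀ t', Equiv.swap (W t) (W t₀) (W t') = W (Equiv.swap t t₀ t') := fun t' =>
      (W.injective.map_swap t t₀ t').symm
    simp only [hsw]
    exact (Equiv.swap t t₀).forall_congr_left.trans (by simp)
  have h1 : (Finset.univ.filter fun σ => PeakGood m k N σ W).card =
      G.card * (Finset.univ.filter fun σ => τ σ = t₀).card := by
    rw [Finset.card_eq_sum_card_fiberwise (f := τ) (t := G)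
      (fun σ hσ => by simpa [hgood] using hσ)]
    rw [← smul_eq_mul, ← Finset.sum_const]
    refine Finset.sum_congr rfl fun t ht => ?_
    rw [← hcard t, Finset.filter_filter]
    congr 1
    ext σ
    simp only [Finset.mem_filter, Finset.mem_univ, true_and, hgood]
    exact ⟨fun h => h.2, fun h => ⟨h ▸ ht, h⟩⟩
  have h2 : Fintype.card (Equiv.Perm (Fin N)) =
      m * (Finset.univ.filter fun σ => τ σ = t₀).card := by
    rw [← Finset.card_univ, Finset.card_eq_sum_card_fiberwise (f := τ) (t := Finset.univ)
      (fun _ _ => Finset.mem_univ _), Finset.sum_congr rfl fun t _ => hcard t]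
    simp
  rw [h1, h2]
  ring

lemma exists_card_peak_ge {μ : ℝ} (hk : 1 ≤ k) (hμ : μ < ((k : ℝ) - 1) / k) : ∃ m, 0 < m ∧
    μ * m ≤ (Finset.univ.filter fun t : Fin m =>
      k ≤ (t : ℕ) ∧ (t : ℕ) + k ≤ m ∧ ¬ k ∣ (t : ℕ)).card := by
  have hk0 : (0 : ℝ) < k := by exact_mod_cast hk
  rw [lt_div_iff₀ hk0] at hμ
  -- This bound on `M` is `μ * k * (M + 2) ≤ M * (k - 1)` rearranged: of `M + 2` blocks of length
  -- `k`, the middle `M` contribute `k - 1` good positions each.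
  obtain ⟨M, hM⟩ := exists_nat_ge (2 * μ * k / ((k : ℝ) - 1 - μ * k))
  rw [div_le_iff₀ (by linarith)] at hM
  refine ⟨k * (M + 2), by positivity, ?_⟩
  have hcard : M * (k - 1) ≤ (Finset.univ.filter fun t : Fin (k * (M + 2)) =>
      k ≤ (t : ℕ) ∧ (t : ℕ) + k ≤ k * (M + 2) ∧ ¬ k ∣ (t : ℕ)).card := by
    have hb : ∀ (a : Fin M) (b : Fin (k - 1)),
        k * ((a : ℕ) + 1) + ((b : ℕ) + 1) + k ≤ k * (M + 2) := fun a b => by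
      have h1 : k * ((a : ℕ) + 1) ≤ k * M := Nat.mul_le_mul_left k a.2
      have h2 := b.2
      have h3 : k * (M + 2) = k * M + k * 2 := Nat.mul_add _ _ _
      omega
    let f : Fin M × Fin (k - 1) → Fin (k * (M + 2)) := fun x =>
      ⟨k * ((x.1 : ℕ) + 1) + ((x.2 : ℕ) + 1), by have := hb x.1 x.2; omega⟩
    have hmod : ∀ x, (f x : ℕ) % k = x.2 + 1 := fun x => by
      have := x.2.2
      simp only [f]
      rw [Nat.mul_add_mod, Nat.mod_eq_of_lt (by omega)]
    have hinj : Function.Injective f := by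
      intro x y h
      have h2 : (x.2 : ℕ) = y.2 := by
        have := hmod x
        rw [h, hmod y] at this
        omega
      have h1 : k * ((x.1 : ℕ) + 1) = k * ((y.1 : ℕ) + 1) := by
        have := congrArg Fin.val h
        simp only [f] at this
        omega
      have h3 := Nat.eq_of_mul_eq_mul_left hk h1
      exact Prod.ext (Fin.ext (by omega)) (Fin.ext h2)
    have hc := Finset.card_image_of_injective Finset.univ hinj
    rw [Finset.card_univ, Fintype.card_prod, Fintype.card_fin, Fintype.card_fin] at hc
    rw [← hc]
    refine Finset.card_le_card fun t ht => ?_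
    obtain ⟨x, -, rfl⟩ := Finset.mem_image.1 ht
    refine Finset.mem_filter.2 ⟨Finset.mem_univ _, ?_, hb x.1 x.2, fun hd => ?_⟩
    · simp only [f, Nat.mul_add]
      omega
    · have := hmod x
      rw [Nat.mod_eq_zero_of_dvd hd] at this
      omega
  have hcard' : (M : ℝ) * ((k : ℝ) - 1) ≤ ((Finset.univ.filter fun t : Fin (k * (M + 2)) =>
      k ≤ (t : ℕ) ∧ (t : ℕ) + k ≤ k * (M + 2) ∧ ¬ k ∣ (t : ℕ)).card : ℝ) := by
    rw [← Nat.cast_one, ← Nat.cast_sub hk]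
    exact_mod_cast hcard
  refine le_trans ?_ hcard'
  push_cast
  nlinarith

end Shift

/-! ### Assembling the finite sets and passing to the union -/

section Assembly

open Combinatorics

variable {d : ℕ}

/-- Every similar copy of `F` in `Z` is degenerate. -/
def SimilarityFree (F Z : Finset (Fin d → ℤ)) : Prop :=
  ∀ q : F → Fin d → ℤ, (∀ a, q a ∈ Z) → IsSimilarity q → ∀ a b, q a = q b

/-- Every subset of `A` has a subset of relative density at least `μ` without similar copies
of `F`. -/
def SimilarityFractional (μ : ℝ) (F A : Finset (Fin d → ℤ)) : Prop :=
  ∀ Y ⊆ A, ∃ Z ⊆ Y, SimilarityFree F Z ∧ μ * (Y.card : ℝ) ≤ Z.card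

/-- Every `r`-colouring of `A` has a monochromatic homothetic copy of `F`. -/
def Arrow (r : ℕ) (F A : Finset (Fin d → ℤ)) : Prop :=
  ∀ χ : (Fin d → ℤ) → Fin r, ∃ g : F → Fin d → ℤ, IsHomothety g ∧ (∀ a, g a ∈ A) ∧
    ∃ c, ∀ a, χ (g a) = c

variable {F : Finset (Fin d → ℤ)} {k : ℕ} {μ : ℝ}

lemma isHomothety_sum_line {ι : Type*} [Fintype ι] (l : Line F ι) :
    IsHomothety fun a : F => ∑ i, (l a i : Fin d → ℤ) := by
  obtain ⟨i₀, hi₀⟩ := l.proper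
  have := isHomothety_sum (w := fun _ : ι => 1) (fun _ => one_pos)
    (g := fun i (a : F) => (l a i : Fin d → ℤ))
    (v := fun i => (l.idxFun i).elim 0 fun y => y) (l := fun i => (l.idxFun i).elim 1 fun _ => 0)
    (fun i => by rcases hi : l.idxFun i with _ | y <;> simp)
    (fun i a => by rcases hi : l.idxFun i with _ | y <;> simp [hi])
    (i₀ := i₀) (by simp [hi₀])
  simpa only [one_smul] using this

lemma exists_similarityFractional_arrow (hk : 3 ≤ k) (hF : F.card = k) (hμ : μ < ((k : ℝ) - 1) / k)
    (r : ℕ) (hr : 1 ≤ r) : ∃ A, SimilarityFractional μ F A ∧ Arrow r F A := by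
  classical
  obtain ⟨m, hm, hμm⟩ := exists_card_peak_ge (by omega) hμ
  obtain ⟨N, hN⟩ := exists_mono_windows r m k hr
  obtain ⟨ι, _, hι⟩ := Line.exists_mono_in_high_dimension F ((Fin m ↪ Fin N) → Fin r)
  let idx : F ≃ Fin k := F.equivFinOfCardEq hF
  -- Pairing windows with words of `F` gives each edge a homothetic image under `s`, as amalgamation
  -- requires. Hales–Jewett, with colourings of windows as colours, later removes the dependence on
  -- the word.
  let E : Set (F → (ι → F) × (Fin m ↪ Fin N)) :=
    {e | ∃ (l : Line F ι) (U : Fin (m + k) ↪ Fin N), e = fun a => (l a, window U (idx a))}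
  let s : (ι → F) × (Fin m ↪ Fin N) → Fin d → ℤ := fun x => ∑ i, (x.1 i : Fin d → ℤ)
  have hs : ∀ e ∈ E, IsHomothety (s ∘ e) := by
    rintro _ ⟨l, U, rfl⟩
    exact isHomothety_sum_line l
  have : Nonempty ((ι → F) × (Fin m ↪ Fin N)) := by
    obtain ⟨U, -⟩ := hN fun _ => ⟨0, hr⟩
    exact ⟨fun _ => idx.symm ⟨0, by omega⟩, window U ⟨0, by omega⟩⟩
  obtain ⟨P, π, hP, hR⟩ := exists_picture_univ (by omega) hr hs
  refine ⟨P, fun Y hY => ?_, fun χ => ?_⟩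
  · have hdens : ∀ W : Fin m ↪ Fin N, μ * (Fintype.card (Equiv.Perm (Fin N)) : ℝ) ≤
        (Finset.univ.filter fun σ => PeakGood m k N σ W).card := fun W => by
      have h1 := card_peakGood (k := k) hm W
      have h2 : (m : ℝ) * ((Finset.univ.filter fun σ => PeakGood m k N σ W).card : ℝ) =
          ((Finset.univ.filter fun t : Fin m =>
            k ≤ (t : ℕ) ∧ (t : ℕ) + k ≤ m ∧ ¬ k ∣ (t : ℕ)).card : ℝ) *
          (Fintype.card (Equiv.Perm (Fin N)) : ℝ) := by exact_mod_cast h1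
      have hm' : (0 : ℝ) < m := by exact_mod_cast hm
      refine le_of_mul_le_mul_left ?_ hm'
      rw [h2, ← mul_assoc, mul_comm (m : ℝ)]
      exact mul_le_mul_of_nonneg_right hμm (Nat.cast_nonneg _)
    -- Double counting: every point of `Y` survives for at least a proportion `μ` of the
    -- permutations, so some permutation keeps `μ * Y.card` points.
    obtain ⟨σ, -, hσ⟩ : ∃ σ ∈ (Finset.univ : Finset (Equiv.Perm (Fin N))), μ * (Y.card : ℝ) ≤
        ((Y.filter fun y => PeakGood m k N σ (π y).2).card : ℝ) := by
      refine Finset.exists_le_of_sum_le Finset.univ_nonempty ?_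
      have hcount := Finset.sum_card_bipartiteAbove_eq_sum_card_bipartiteBelow
        (s := (Finset.univ : Finset (Equiv.Perm (Fin N)))) (t := Y)
        fun σ y => PeakGood m k N σ (π y).2
      simp only [Finset.bipartiteAbove, Finset.bipartiteBelow] at hcount
      rw [← Nat.cast_sum, hcount, Nat.cast_sum]
      refine le_trans (le_of_eq ?_) (Finset.sum_le_sum fun y _ => hdens (π y).2)
      simp only [Finset.sum_const, nsmul_eq_mul, Finset.card_univ]
      ring
    refine ⟨_, Finset.filter_subset _ _, fun q hq hsim => ?_, hσ⟩
    rcases hP q (fun a => hY (Finset.mem_filter.1 (hq a)).1) hsim with h | ⟨_, ⟨l, U, rfl⟩, h⟩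
    · exact h
    · exfalso
      obtain ⟨j, hj⟩ := exists_not_peakGood (by omega) σ U
      obtain ⟨b, hb⟩ : (l (idx.symm j), window U (idx (idx.symm j))) ∈ Set.range (π ∘ q) := by
        rw [h]
        exact ⟨idx.symm j, rfl⟩
      have h1 := (Finset.mem_filter.1 (hq b)).2
      rw [Function.comp_apply] at hb
      rw [hb, Equiv.apply_symm_apply] at h1
      exact hj h1
  · obtain ⟨κ, hκ⟩ := hR χ
    obtain ⟨l, c, hl⟩ := hι fun w W => κ (w, W)
    obtain ⟨U, c₀, hU⟩ := hN c
    obtain ⟨g, hg, hge⟩ := hκ _ ⟨l, U, rfl⟩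
    refine ⟨g, hg, fun a => (hge a).1, c₀, fun a => ?_⟩
    rw [(hge a).2.2 (Finset.mem_univ _), ← hU (idx a), ← hl a]

lemma eventually_sqDist_mul_ne (hd : 0 < d) (x y : Fin d → ℤ) (c D : ℤ) (hc : c ≠ 0) :
    ∀ᶠ L : ℤ in Filter.atTop, sqDist x (L • 1 + y) * c ≠ D := by
  filter_upwards [eventually_quadratic_eq_zero (sqDist x y * c - D)
    (2 * (((0 : Fin d → ℤ) - 1) ⬝ᵥ (x - y)) * c) (sqDist (0 : Fin d → ℤ) 1 * c)] with L hL h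
  have h1 := sqDist_smul_add L 0 1 x y
  rw [smul_zero, zero_add] at h1
  rw [h1] at h
  rcases mul_eq_zero.1 (hL (by linear_combination h)).2 with h2 | h2
  · have := congrFun (sqDist_eq_zero.1 h2) ⟨0, hd⟩
    simp at this
  · exact hc h2

/-- Translate `B` far along the all-ones vector. A copy meeting both parts has, among three of its
points, one cross distance and one distance within a part. Their ratio would be one of finitely many
determined by `F`, which large `L` avoids. Hence copies stay in one part and densities add. -/
lemma exists_similarityFractional_union (hF : 3 ≤ F.card) {A B : Finset (Fin d → ℤ)}
    (hA : SimilarityFractional μ F A) (hB : SimilarityFractional μ F B) (hA0 : ∀ x ∈ A, ∀ i, 0 < x i) :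
    ∃ A', A ⊆ A' ∧ SimilarityFractional μ F A' ∧ (∀ x ∈ A', ∀ i, 0 < x i) ∧
      ∀ r, Arrow r F B → Arrow r F A' := by
  classical
  have hd : 0 < d := by
    rcases Nat.eq_zero_or_pos d with rfl | hd
    · have := Finset.card_le_one_of_subsingleton F
      omega
    · exact hd
  have hpos : ∀ᶠ L : ℤ in Filter.atTop, ∀ (y : B) (i : Fin d), 0 < L + (y : Fin d → ℤ) i := by
    simp only [Filter.eventually_all]
    intro y i
    filter_upwards [Filter.eventually_gt_atTop (-(y : Fin d → ℤ) i)] with L hL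
    linarith
  have hdisj : ∀ᶠ L : ℤ in Filter.atTop, ∀ (x : A) (y : B),
      (x : Fin d → ℤ) ≠ L • 1 + (y : Fin d → ℤ) := by
    simp only [Filter.eventually_all]
    intro x y
    filter_upwards [eventually_sqDist_mul_ne hd x y 1 0 one_ne_zero] with L hL h
    rw [mul_one] at hL
    exact hL (sqDist_eq_zero.2 h)
  have hsep : ∀ᶠ L : ℤ in Filter.atTop, ∀ (x : A) (y : B) (f f' f'' : F), f ≠ f' →
      (∀ x' : A, sqDist (x : Fin d → ℤ) (L • 1 + y) * sqDist (f : Fin d → ℤ) f' ≠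
        sqDist (x : Fin d → ℤ) x' * sqDist (f : Fin d → ℤ) f'') ∧
      ∀ y' : B, sqDist (x : Fin d → ℤ) (L • 1 + y) * sqDist (f : Fin d → ℤ) f' ≠
        sqDist (y : Fin d → ℤ) y' * sqDist (f : Fin d → ℤ) f'' := by
    simp only [Filter.eventually_all, Filter.eventually_and]
    intro x y f f' f'' hf
    have hf' : sqDist (f : Fin d → ℤ) f' ≠ 0 := fun h => hf (Subtype.ext (sqDist_eq_zero.1 h))
    exact ⟨fun x' => eventually_sqDist_mul_ne hd x y _ _ hf',
      fun y' => eventually_sqDist_mul_ne hd x y _ _ hf'⟩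
  obtain ⟨L, hL0, hL1, hL2⟩ := (hpos.and (hdisj.and hsep)).exists
  let τ : (Fin d → ℤ) → Fin d → ℤ := fun y => L • 1 + y
  have hτ : Function.Injective τ := add_right_injective _
  have hτd : ∀ y y', sqDist (τ y) (τ y') = sqDist y y' := fun y y' => by
    simp only [sqDist, τ, add_sub_add_left_eq_sub]
  have hmix : ∀ q : F → Fin d → ℤ, (∀ a, q a ∈ A ∪ B.image τ) → IsSimilarity q →
      (∀ a, q a ∈ A) ∨ ∀ a, q a ∈ B.image τ := by
    intro q hq hs
    by_contra! hcon
    obtain ⟨⟨b, hb⟩, a, ha⟩ := hcon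
    have ha' := (Finset.mem_union.1 (hq a)).resolve_right ha
    obtain ⟨y, hy, hyb⟩ := Finset.mem_image.1 ((Finset.mem_union.1 (hq b)).resolve_left hb)
    obtain ⟨c, hca, hcb⟩ := exists_three hF a b
    rcases Finset.mem_union.1 (hq c) with hc | hc
    · have h1 := hs a b a c
      rw [← hyb] at h1
      exact (hL2 ⟨q a, ha'⟩ ⟨y, hy⟩ a c b (Ne.symm hca)).1 ⟨q c, hc⟩ h1
    · obtain ⟨y', hy', hyc⟩ := Finset.mem_image.1 hc
      have h1 := hs a b b c
      rw [← hyb, ← hyc, hτd, sqDist_comm (a : Fin d → ℤ)] at h1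
      exact (hL2 ⟨q a, ha'⟩ ⟨y, hy⟩ b c a (Ne.symm hcb)).2 ⟨y', hy'⟩ h1
  refine ⟨A ∪ B.image τ, Finset.subset_union_left, fun Y hY => ?_, fun x hx i => ?_,
    fun r hr χ => ?_⟩
  · obtain ⟨Z₁, hZ₁, hf₁, hc₁⟩ := hA (Y.filter (· ∈ A)) fun y hy => (Finset.mem_filter.1 hy).2
    obtain ⟨Z₂, hZ₂, hf₂, hc₂⟩ := hB (B.filter fun y => τ y ∈ Y) (Finset.filter_subset _ _)
    have hY₂ : (B.filter fun y => τ y ∈ Y).card = (Y.filter (· ∉ A)).card := by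
      rw [← Finset.card_image_of_injective _ hτ]
      congr 1
      ext y
      simp only [Finset.mem_image, Finset.mem_filter]
      constructor
      · rintro ⟨z, ⟨hz, hzY⟩, rfl⟩
        exact ⟨hzY, fun h => hL1 ⟨_, h⟩ ⟨z, hz⟩ rfl⟩
      · rintro ⟨hy, hyA⟩
        obtain ⟨z, hz, rfl⟩ :=
          Finset.mem_image.1 ((Finset.mem_union.1 (hY hy)).resolve_left hyA)
        exact ⟨z, ⟨hz, hy⟩, rfl⟩
    have hZ₁A : ∀ z ∈ Z₁, z ∈ A := fun z hz => (Finset.mem_filter.1 (hZ₁ hz)).2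
    have hZ₂B : ∀ z ∈ Z₂, z ∈ B := fun z hz => (Finset.mem_filter.1 (hZ₂ hz)).1
    have hAB : ∀ x ∈ A, x ∉ B.image τ := fun x hx h => by
      obtain ⟨z, hz, rfl⟩ := Finset.mem_image.1 h
      exact hL1 ⟨_, hx⟩ ⟨z, hz⟩ rfl
    refine ⟨Z₁ ∪ Z₂.image τ, ?_, fun q hq hs => ?_, ?_⟩
    · refine Finset.union_subset (hZ₁.trans (Finset.filter_subset _ _)) fun y hy => ?_
      obtain ⟨z, hz, rfl⟩ := Finset.mem_image.1 hy
      exact (Finset.mem_filter.1 (hZ₂ hz)).2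
    · rcases hmix q (fun a => Finset.union_subset_union hZ₁A
        (Finset.image_subset_image hZ₂B) (hq a)) hs with h | h
      · refine hf₁ q (fun a => (Finset.mem_union.1 (hq a)).resolve_right fun h' => ?_) hs
        exact hAB _ (h a) (Finset.image_subset_image hZ₂B h')
      · have : ∀ a, ∃ z ∈ Z₂, τ z = q a := fun a =>
          Finset.mem_image.1 ((Finset.mem_union.1 (hq a)).resolve_left fun h' =>
            hAB _ (hZ₁A _ h') (h a))
        choose z hz hzq using this
        intro a b
        rw [← hzq, ← hzq]
        congr 1
        refine hf₂ z hz (fun a b a' b' => ?_) a b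
        rw [← hτd, ← hτd (z a'), hzq, hzq, hzq, hzq]
        exact hs a b a' b'
    · have hcard : (Z₁ ∪ Z₂.image τ).card = Z₁.card + Z₂.card := by
        rw [Finset.card_union_of_disjoint, Finset.card_image_of_injective _ hτ]
        exact Finset.disjoint_left.2 fun x hx hx' =>
          hAB x (hZ₁A x hx) (Finset.image_subset_image hZ₂B hx')
      rw [hcard, ← Finset.card_filter_add_card_filter_not (s := Y) (· ∈ A), ← hY₂]
      push_cast
      linarith
  · rcases Finset.mem_union.1 hx with h | h
    · exact hA0 x h i
    · obtain ⟨y, hy, rfl⟩ := Finset.mem_image.1 h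
      simpa [τ] using hL0 ⟨y, hy⟩ i
  · obtain ⟨g, ⟨v, l, hl, hg⟩, hgB, c, hc⟩ := hr (χ ∘ τ)
    refine ⟨τ ∘ g, ⟨L • 1 + v, l, hl, fun a => ?_⟩, fun a => ?_, c, hc⟩
    · simp only [Function.comp_apply, τ, hg, add_assoc]
    · exact Finset.mem_union_right _ (Finset.mem_image_of_mem τ (hgB a))

lemma dist_latticeToEuclidean_sq (x y : Fin d → ℤ) :
    dist (latticeToEuclidean x) (latticeToEuclidean y) ^ 2 = (sqDist x y : ℝ) := by
  rw [EuclideanSpace.dist_eq, Real.sq_sqrt (Finset.sum_nonneg fun _ _ => sq_nonneg _)]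
  simp only [latticeToEuclidean, Real.dist_eq, sq_abs, sqDist, dotProduct, Pi.sub_apply]
  push_cast
  exact Finset.sum_congr rfl fun i _ => by ring

lemma SimilarityFree.isConfigFree (hF : 3 ≤ F.card) {Z : Finset (Fin d → ℤ)}
    (hZ : SimilarityFree F Z) : IsConfigFree (F : Set (Fin d → ℤ)) (Z : Set (Fin d → ℤ)) := by
  rintro ⟨c, hc, W, hW, e, he⟩
  let p : F → (c • (latticeToEuclidean '' (F : Set (Fin d → ℤ))) :
      Set (EuclideanSpace ℝ (Fin d))) := fun a =>
    ⟨c • latticeToEuclidean a, Set.smul_mem_smul_set (Set.mem_image_of_mem _ a.2)⟩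
  choose q hqZ hq using fun a : F => hW (e.symm (p a)).2
  have hdist : ∀ a b, (sqDist (q a) (q b) : ℝ) = c ^ 2 * sqDist (a : Fin d → ℤ) b := fun a b => by
    have h1 := he (e.symm (p a)) (e.symm (p b))
    simp only [Equiv.apply_symm_apply, edist_dist] at h1
    rw [ENNReal.ofReal_eq_ofReal_iff dist_nonneg dist_nonneg] at h1
    rw [← dist_latticeToEuclidean_sq, hq, hq, h1, dist_smul₀, mul_pow,
      dist_latticeToEuclidean_sq, Real.norm_eq_abs, sq_abs]
  have hs : IsSimilarity q := fun a b a' b' => by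
    have : (sqDist (q a) (q b) : ℝ) * sqDist (a' : Fin d → ℤ) b' =
        sqDist (q a') (q b') * sqDist (a : Fin d → ℤ) b := by
      rw [hdist, hdist]; ring
    exact_mod_cast this
  obtain ⟨a, ha⟩ := Finset.card_pos.1 (show 0 < F.card by omega)
  obtain ⟨b, hb, -⟩ := exists_three hF ⟨a, ha⟩ ⟨a, ha⟩
  have h1 := hdist ⟨a, ha⟩ b
  rw [sqDist_eq_zero.2 (hZ q hqZ hs _ b), Int.cast_zero, eq_comm, mul_eq_zero] at h1
  rcases h1 with h1 | h1
  · exact hc (pow_eq_zero_iff two_ne_zero |>.1 h1)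
  · exact hb (Subtype.ext (sqDist_eq_zero.1 (Int.cast_eq_zero.1 h1)).symm)

lemma exists_similarityFractional_chain (hk : 3 ≤ k) (hF : F.card = k) (hμ : μ < ((k : ℝ) - 1) / k) :
    ∃ A : ℕ → Finset (Fin d → ℤ), Monotone A ∧ ∀ n, SimilarityFractional μ F (A n) ∧
      (∀ x ∈ A n, ∀ i, 0 < x i) ∧ Arrow (n + 1) F (A (n + 1)) := by
  let T := {A : Finset (Fin d → ℤ) // SimilarityFractional μ F A ∧ ∀ x ∈ A, ∀ i, 0 < x i}
  have hstep : ∀ (n : ℕ) (A : T), ∃ A' : T, A.1 ⊆ A'.1 ∧ Arrow (n + 1) F A'.1 := fun n A => by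
    obtain ⟨B, hB, hBr⟩ := exists_similarityFractional_arrow hk hF hμ (n + 1) (by omega)
    obtain ⟨A', h1, h2, h3, h4⟩ := exists_similarityFractional_union (by omega) A.2.1 hB A.2.2
    exact ⟨⟨A', h2, h3⟩, h1, h4 _ hBr⟩
  choose next hsub harr using hstep
  have h0 : SimilarityFractional μ F (∅ : Finset (Fin d → ℤ)) := fun Y hY => by
    obtain rfl := Finset.subset_empty.1 hY
    obtain ⟨a, ha⟩ := Finset.card_pos.1 (show 0 < F.card by omega)
    exact ⟨∅, subset_rfl, fun q hq => absurd (hq ⟨a, ha⟩) (Finset.notMem_empty _), by simp⟩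
  let A : ℕ → T := fun n => Nat.rec ⟨∅, h0, by simp⟩ (fun n A => next n A) n
  exact ⟨fun n => (A n).1, monotone_nat_of_le_succ fun n => hsub n (A n),
    fun n => ⟨(A n).2.1, (A n).2.2, harr n (A n)⟩⟩

end Assembly

theorem theorem1p5 (d k : ℕ) (hk : 3 ≤ k) (F : Finset (Fin d → ℤ)) (hF : F.card = k)
    (μ : ℝ) (hμ0 : 0 < μ) (hμ1 : μ < ((k : ℝ) - 1) / (k : ℝ)) :
    ∃ X : Set (Fin d → ℤ),
      (∀ x ∈ X, ∀ i, 0 < x i) ∧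
      (∀ r : ℕ, 1 ≤ r → ∀ χ : X → Fin r,
        ∃ F' : Set (Fin d → ℤ), IsHomotheticCopy (F : Set (Fin d → ℤ)) F' ∧ F' ⊆ X ∧
          ∃ a : Fin r, ∀ x : X, (x : Fin d → ℤ) ∈ F' → χ x = a) ∧
      (∀ Y : Finset (Fin d → ℤ), (Y : Set (Fin d → ℤ)) ⊆ X →
        ∃ Z : Finset (Fin d → ℤ), Z ⊆ Y ∧
          IsConfigFree (F : Set (Fin d → ℤ)) (Z : Set (Fin d → ℤ)) ∧
          μ * (Y.card : ℝ) ≤ (Z.card : ℝ)) := by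
  classical
  obtain ⟨A, hmono, hA⟩ := exists_similarityFractional_chain hk hF hμ1
  refine ⟨⋃ n, (A n : Set (Fin d → ℤ)), fun x hx => ?_, fun r hr χ => ?_, fun Y hY => ?_⟩
  · obtain ⟨n, hn⟩ := Set.mem_iUnion.1 hx
    exact (hA n).2.1 x hn
  · obtain ⟨n, rfl⟩ : ∃ n, r = n + 1 := ⟨r - 1, by omega⟩
    obtain ⟨g, ⟨v, l, hl, hg⟩, hgA, c, hc⟩ := (hA n).2.2 fun x =>
      if h : x ∈ ⋃ n, (A n : Set (Fin d → ℤ)) then χ ⟨x, h⟩ else 0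
    have hX : ∀ a, g a ∈ ⋃ n, (A n : Set (Fin d → ℤ)) := fun a =>
      Set.mem_iUnion.2 ⟨n + 1, hgA a⟩
    refine ⟨_, ⟨v, l, hl, rfl⟩, ?_, c, ?_⟩
    · rintro _ ⟨f, hf, rfl⟩
      have := hX ⟨f, hf⟩
      rwa [hg] at this
    · rintro ⟨x, hx⟩ ⟨f, hf, rfl⟩
      have := hc ⟨f, hf⟩
      rw [hg, dif_pos hx] at this
      exact this
  · choose! f hf using fun x (hx : x ∈ ⋃ n, (A n : Set (Fin d → ℤ))) => Set.mem_iUnion.1 hx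
    -- A finite `Y` lies in a single member of the chain, so the density property of that finite
    -- stage applies.
    obtain ⟨Z, hZ, hfree, hc⟩ := (hA (Y.sup f)).1 Y fun y hy =>
      hmono (Finset.le_sup hy) (hf y (hY hy))
    exact ⟨Z, hZ, hfree.isConfigFree (by omega), hc⟩
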